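/- Let $s$ be the space of rapidly decreasing sequences, i.e. of all $\xi=(\xi_j)_{j\ge 1}\in\mathbb C^{\mathbb N}$ with $|\xi|_q:=\big(\sum_{j}|\xi_j|^2j^{2q}\big)^{1/2}<\infty$ for all $q\in\mathbb N_0$, with the topology of the norms $|\cdot|_q$, and let $s'$ be the space of all sequences $\xi$ with $|\xi|'_q:=\big(\sum_{j}|\xi_j|^2j^{-2q}\big)^{1/2}<\infty$ for some $q\in\mathbb N_0$, with the inductive limit topology. Let $L(s',s)$ be the algebra of continuous linear operators $s'\to s$, with the topology of the norms $\|x\|_q:=\sup_{|\xi|'_q\le 1}|x\xi|_q$ ($q\in\mathbb N_0$), with multiplication $xy:=x\circ j\circ y$, where $j\colon s\hookrightarrow s'$ is the inclusion, and with the Hilbert space adjoint on $\ell_2$ as involution; via $\ell_2\hookrightarrow s'\to s\hookrightarrow\ell_2$ it is regarded as a subalgebra of $L(\ell_2)$. Let $A$ be a closed ${}^*$-subalgebra of $L(s',s)$ (not necessarily commutative), and let $x\in L(s',s)$ be normal and infinite dimensional (i.e. of infinite rank), with spectral representation $x=\sum_{n=1}^\infty\lambda_nP_n$: here the $\lambda_n$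 are nonzero pairwise different complex numbers with $|\lambda_1|\ge|\lambda_2|\ge\dots$, the $P_n$ are nonzero pairwise orthogonal finite-dimensional orthogonal projections on $\ell_2$, and the series converges in the operator norm of $L(\ell_2)$. Then $$x\in A\quad\Longleftrightarrow\quad P_n\in A\ \text{ for all } n\in\mathbb N.$$ -/

import Mathlib

open Filter Topology

noncomputable section

namespace SmoothOperators

/-! ## Weighted square-summable sequences, indexed by the positive integers -/

/-- `∑ |ξ_j|² j^{2k} < ∞`, for an integer exponent `k`. -/
def WSum (k : ℤ) (ξ : ℕ+ → ℂ) : Prop :=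
  Summable fun j : ℕ+ => ‖ξ j‖ ^ 2 * (j : ℝ) ^ (2 * k)

/-- `(∑ |ξ_j|² j^{2k})^{1/2}`; meaningful when `WSum k ξ` holds. -/
def wnorm (k : ℤ) (ξ : ℕ+ → ℂ) : ℝ :=
  Real.sqrt (∑' j : ℕ+, ‖ξ j‖ ^ 2 * (j : ℝ) ^ (2 * k))

/-- The Hilbert space `ℓ₂`. -/
abbrev L2 : Type := lp (fun _ : ℕ+ => ℂ) 2

lemma pnat_pos (j : ℕ+) : (0 : ℝ) < (j : ℝ) := by exact_mod_cast j.pos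

lemma norm_wt_sq (k : ℤ) (ξ : ℕ+ → ℂ) (j : ℕ+) :
    ‖((j : ℝ) ^ k) • ξ j‖ ^ 2 = ‖ξ j‖ ^ 2 * (j : ℝ) ^ (2 * k) := by
  have h := pnat_pos j
  rw [norm_smul, Real.norm_of_nonneg (zpow_nonneg h.le _), mul_pow, mul_comm 2 k, zpow_mul]
  rw [mul_comm]
  norm_cast

lemma wsum_iff (k : ℤ) (ξ : ℕ+ → ℂ) :
    WSum k ξ ↔ Memℓp (fun j : ℕ+ => ((j : ℝ) ^ k) • ξ j) 2 := by
  rw [memℓp_gen_iff (by norm_num)]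
  simp only [ENNReal.toReal_ofNat, Real.rpow_two, norm_wt_sq]
  rfl

/-- The weighted sequence `(j^k ξ_j)`, as an element of `ℓ₂`. -/
def weighted (k : ℤ) (ξ : ℕ+ → ℂ) (h : WSum k ξ) : L2 :=
  ⟨fun j => ((j : ℝ) ^ k) • ξ j, (wsum_iff k ξ).1 h⟩

lemma norm_weighted (k : ℤ) (ξ : ℕ+ → ℂ) (h : WSum k ξ) : ‖weighted k ξ h‖ = wnorm k ξ := by
  rw [lp.norm_eq_tsum_rpow (by norm_num), wnorm, Real.sqrt_eq_rpow]
  simp only [ENNReal.toReal_ofNat, Real.rpow_two]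
  congr 2
  funext j
  exact norm_wt_sq k ξ j

lemma WSum.zero (k : ℤ) : WSum k 0 := by
  simp [WSum]

lemma WSum.add {k : ℤ} {ξ η : ℕ+ → ℂ} (h : WSum k ξ) (h' : WSum k η) : WSum k (ξ + η) := by
  rw [wsum_iff] at *
  convert h.add h' using 1
  funext j
  simp only [smul_add, Pi.add_apply]

lemma WSum.smul {k : ℤ} {ξ : ℕ+ → ℂ} (c : ℂ) (h : WSum k ξ) : WSum k (c • ξ) := by
  rw [wsum_iff] at *
  convert h.const_smul c using 1
  funext j
  simp [mul_left_comm]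

lemma WSum.sub {k : ℤ} {ξ η : ℕ+ → ℂ} (h : WSum k ξ) (h' : WSum k η) : WSum k (ξ - η) := by
  have := h.add (h'.smul (-1))
  rwa [neg_one_smul, ← sub_eq_add_neg] at this

lemma wnorm_nonneg (k : ℤ) (ξ : ℕ+ → ℂ) : 0 ≤ wnorm k ξ := Real.sqrt_nonneg _

lemma wnorm_zero (k : ℤ) : wnorm k 0 = 0 := by simp [wnorm]

lemma wnorm_add_le {k : ℤ} {ξ η : ℕ+ → ℂ} (h : WSum k ξ) (h' : WSum k η) :
    wnorm k (ξ + η) ≤ wnorm k ξ + wnorm k η := by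
  rw [← norm_weighted k _ h, ← norm_weighted k _ h', ← norm_weighted k _ (h.add h')]
  have : weighted k (ξ + η) (h.add h') = weighted k ξ h + weighted k η h' := by
    ext j; exact smul_add _ _ _
  rw [this]
  exact norm_add_le _ _

lemma wnorm_smul (k : ℤ) (c : ℂ) (ξ : ℕ+ → ℂ) :
    wnorm k (c • ξ) = ‖c‖ * wnorm k ξ := by
  simp only [wnorm, Pi.smul_apply, norm_smul, mul_pow, mul_assoc]
  rw [tsum_mul_left, Real.sqrt_mul (by positivity), Real.sqrt_sq (norm_nonneg _)]

lemma WSum.mono {k l : ℤ} (hkl : k ≤ l) {ξ : ℕ+ → ℂ} (h : WSum l ξ) : WSum k ξ := by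
  refine Summable.of_nonneg_of_le (fun j => ?_) (fun j => ?_) h
  · have := pnat_pos j; positivity
  · have : (1 : ℝ) ≤ j := by exact_mod_cast j.pos
    gcongr

lemma wnorm_mono {k l : ℤ} (hkl : k ≤ l) {ξ : ℕ+ → ℂ} (h : WSum l ξ) :
    wnorm k ξ ≤ wnorm l ξ := by
  refine Real.sqrt_le_sqrt (Summable.tsum_le_tsum (fun j => ?_) (h.mono hkl) h)
  have : (1 : ℝ) ≤ j := by exact_mod_cast j.pos
  gcongr

lemma norm_le_wnorm {k : ℤ} {ξ : ℕ+ → ℂ} (h : WSum k ξ) (j : ℕ+) :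
    (j : ℝ) ^ k * ‖ξ j‖ ≤ wnorm k ξ := by
  rw [← norm_weighted k _ h]
  have := lp.norm_apply_le_norm (p := 2) (by norm_num) (weighted k ξ h) j
  refine le_trans (le_of_eq ?_) this
  simp [weighted]

/-- Cauchy-Schwarz for the pairing `∑ ξ_j conj(η_j)`. -/
lemma pairing {k : ℤ} {ξ η : ℕ+ → ℂ} (h : WSum k ξ) (h' : WSum (-k) η) :
    Summable (fun j => ξ j * star (η j)) ∧
      ‖∑' j, ξ j * star (η j)‖ ≤ wnorm k ξ * wnorm (-k) η := by
  have hs := lp.hasSum_inner (𝕜 := ℂ) (weighted (-k) η h') (weighted k ξ h)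
  have he : (fun j => inner ℂ (weighted (-k) η h' j) (weighted k ξ h j)) =
      fun j => ξ j * star (η j) := by
    funext j
    have hj : ((j : ℝ) : ℂ) ≠ 0 := by exact_mod_cast (pnat_pos j).ne'
    have hj2 : (((j : ℝ) ^ k : ℝ) : ℂ) ≠ 0 := by
      exact_mod_cast (zpow_pos (pnat_pos j) k).ne'
    change inner ℂ (((j : ℝ) ^ (-k)) • η j) (((j : ℝ) ^ k) • ξ j) = _
    rw [RCLike.inner_apply, Complex.real_smul, Complex.real_smul, map_mul, Complex.conj_ofReal,
      zpow_neg, Complex.ofReal_inv]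
    field_simp
    rfl
  rw [he] at hs
  refine ⟨hs.summable, ?_⟩
  rw [hs.tsum_eq, ← norm_weighted k ξ h, ← norm_weighted (-k) η h', mul_comm]
  exact norm_inner_le_norm _ _

/-- The canonical unit sequences. -/
def unitSeq (k : ℕ+) : ℕ+ → ℂ := Pi.single k 1

lemma wsum_unitSeq (l : ℤ) (k : ℕ+) : WSum l (unitSeq k) := by
  refine summable_of_ne_finset_zero (s := {k}) fun j hj => ?_
  have : j ≠ k := by simpa using hj
  simp [unitSeq, this]

lemma wnorm_unitSeq (l : ℤ) (k : ℕ+) : wnorm l (unitSeq k) = (k : ℝ) ^ l := by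
  rw [wnorm, tsum_eq_single k (fun j hj => by simp [unitSeq, hj])]
  have := pnat_pos k
  simp only [unitSeq, Pi.single_eq_same, norm_one, one_pow, one_mul]
  rw [mul_comm 2 l, zpow_mul]
  exact Real.sqrt_sq (zpow_nonneg this.le _)

/-- The finite sections of a sequence converge to it. -/
lemma tendsto_section (k : ℤ) (ξ : ℕ+ → ℂ) :
    Tendsto (fun F : Finset ℕ+ => wnorm k (ξ - ∑ j ∈ F, ξ j • unitSeq j)) atTop (𝓝 0) := by
  classical
  have h1 : ∀ F : Finset ℕ+, wnorm k (ξ - ∑ j ∈ F, ξ j • unitSeq j) =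
      Real.sqrt (∑' j : {j // j ∉ F}, ‖ξ j‖ ^ 2 * ((j : ℕ+) : ℝ) ^ (2 * k)) := by
    intro F
    rw [wnorm]
    congr 1
    have h2 : ∀ j, (ξ - ∑ i ∈ F, ξ i • unitSeq i) j = if j ∈ F then 0 else ξ j := by
      intro j
      rw [Pi.sub_apply, Finset.sum_apply]
      simp only [unitSeq, Pi.smul_apply, Pi.single_apply, smul_eq_mul, mul_ite, mul_one, mul_zero,
        Finset.sum_ite_eq]
      split_ifs <;> simp
    rw [show (fun j : {j // j ∉ F} => ‖ξ j‖ ^ 2 * ((j : ℕ+) : ℝ) ^ (2 * k)) =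
      fun j : {j | j ∉ F} => (fun j : ℕ+ => ‖ξ j‖ ^ 2 * (j : ℝ) ^ (2 * k)) j from rfl]
    refine Eq.trans ?_ (tsum_subtype {j | j ∉ F} (fun j : ℕ+ => ‖ξ j‖ ^ 2 * (j : ℝ) ^ (2 * k))).symm
    refine tsum_congr fun j => ?_
    rw [h2]
    by_cases hj : j ∈ F <;> simp [hj, Set.indicator]
  simp only [h1]
  have h3 := (Real.continuous_sqrt.tendsto 0).comp
    (tendsto_tsum_compl_atTop_zero fun j : ℕ+ => ‖ξ j‖ ^ 2 * (j : ℝ) ^ (2 * k))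
  rw [Real.sqrt_zero] at h3
  exact h3

/-! ## The spaces `s` and `s'` -/

/-- The rapidly decreasing sequences. -/
def rapidSubmodule : Submodule ℂ (ℕ+ → ℂ) where
  carrier := {ξ | ∀ q : ℕ, WSum q ξ}
  add_mem' h h' q := (h q).add (h' q)
  zero_mem' q := WSum.zero q
  smul_mem' c _ h q := (h q).smul c

/-- The slowly increasing sequences. -/
def slowSubmodule : Submodule ℂ (ℕ+ → ℂ) where
  carrier := {ξ | ∃ q : ℕ, WSum (-q) ξ}
  add_mem' := by
    rintro ξ η ⟨q, h⟩ ⟨r, h'⟩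
    exact ⟨max q r, (h.mono (by simp)).add (h'.mono (by simp))⟩
  zero_mem' := ⟨0, WSum.zero _⟩
  smul_mem' := by
    rintro c ξ ⟨q, h⟩
    exact ⟨q, h.smul c⟩

/-- The space `s` (it does not carry the topology of pointwise convergence). -/
def RapidSeq : Type := rapidSubmodule

/-- The space `s'` (it does not carry the topology of pointwise convergence). -/
def SlowSeq : Type := slowSubmodule

instance : AddCommGroup RapidSeq := inferInstanceAs (AddCommGroup rapidSubmodule)
instance : Module ℂ RapidSeq := inferInstanceAs (Module ℂ rapidSubmodule)
instance : AddCommGroup SlowSeq := inferInstanceAs (AddCommGroup slowSubmodule)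
instance : Module ℂ SlowSeq := inferInstanceAs (Module ℂ slowSubmodule)

/-- The terms of a sequence in `s`. -/
def RapidSeq.seq : RapidSeq →ₗ[ℂ] (ℕ+ → ℂ) := rapidSubmodule.subtype

/-- The terms of a sequence in `s'`. -/
def SlowSeq.seq : SlowSeq →ₗ[ℂ] (ℕ+ → ℂ) := slowSubmodule.subtype

lemma RapidSeq.wsum (ξ : RapidSeq) (q : ℕ) : WSum q ξ.seq := ξ.2 q
lemma SlowSeq.wsum (ξ : SlowSeq) : ∃ q : ℕ, WSum (-q) ξ.seq := ξ.2
lemma RapidSeq.ext {ξ η : RapidSeq} (h : ξ.seq = η.seq) : ξ = η := Subtype.ext h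
lemma SlowSeq.ext {ξ η : SlowSeq} (h : ξ.seq = η.seq) : ξ = η := Subtype.ext h

/-- A sequence with all weighted norms finite, as an element of `s`. -/
def RapidSeq.mk (ξ : ℕ+ → ℂ) (h : ∀ q : ℕ, WSum q ξ) : RapidSeq := ⟨ξ, h⟩

/-- A sequence with some weighted norm finite, as an element of `s'`. -/
def SlowSeq.mk (ξ : ℕ+ → ℂ) (h : ∃ q : ℕ, WSum (-q) ξ) : SlowSeq := ⟨ξ, h⟩

lemma RapidSeq.seq_mk (ξ : ℕ+ → ℂ) (h) : (RapidSeq.mk ξ h).seq = ξ := rfl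
lemma SlowSeq.seq_mk (ξ : ℕ+ → ℂ) (h) : (SlowSeq.mk ξ h).seq = ξ := rfl

/-- The norms `|ξ|_q` of `s`. -/
def rapidNorm : SeminormFamily ℂ RapidSeq ℕ := fun q =>
  Seminorm.of (fun ξ => wnorm q ξ.seq)
    (fun ξ η => by rw [map_add]; exact wnorm_add_le (ξ.wsum q) (η.wsum q))
    (fun c ξ => by rw [map_smul]; exact wnorm_smul q c ξ.seq)

lemma rapidNorm_apply (q : ℕ) (ξ : RapidSeq) : rapidNorm q ξ = wnorm q ξ.seq := rfl

/-- The Fréchet topology of `s`. -/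
instance : TopologicalSpace RapidSeq := rapidNorm.moduleFilterBasis.topology

lemma withSeminorms_rapid : WithSeminorms rapidNorm := ⟨rfl⟩

/-- The seminorms on `s'` whose restriction to each of the steps `{ξ : |ξ|'_q < ∞}` is continuous
for the norm `|·|'_q`. -/
abbrev StepSeminorm : Type :=
  {p : Seminorm ℂ SlowSeq //
    ∀ q : ℕ, ∃ C : ℝ, ∀ ξ : SlowSeq, WSum (-q) ξ.seq → p ξ ≤ C * wnorm (-q) ξ.seq}

/-- All the step-continuous seminorms. -/
def slowSeminorms : SeminormFamily ℂ SlowSeq StepSeminorm := fun p => p.1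

/-- The (locally convex) inductive limit topology of `s'`, that is, the finest locally convex
topology for which the inclusions of all the steps are continuous. -/
instance : TopologicalSpace SlowSeq := slowSeminorms.moduleFilterBasis.topology

lemma withSeminorms_slow : WithSeminorms slowSeminorms := ⟨rfl⟩

instance : IsTopologicalAddGroup RapidSeq := withSeminorms_rapid.topologicalAddGroup
instance : ContinuousSMul ℂ RapidSeq := withSeminorms_rapid.continuousSMul
instance : IsTopologicalAddGroup SlowSeq := withSeminorms_slow.topologicalAddGroup
instance : ContinuousSMul ℂ SlowSeq := withSeminorms_slow.continuousSMul

lemma stepBound_of_continuous (p : Seminorm ℂ SlowSeq) (hp : Continuous p) (q : ℕ) :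
    ∃ C : ℝ, 0 ≤ C ∧ ∀ ξ : SlowSeq, WSum (-q) ξ.seq → p ξ ≤ C * wnorm (-q) ξ.seq := by
  obtain ⟨s, C, -, hC⟩ := Seminorm.bound_of_continuous withSeminorms_slow p hp
  have key : ∃ D : ℝ, 0 ≤ D ∧ ∀ ξ : SlowSeq, WSum (-q) ξ.seq →
      s.sup slowSeminorms ξ ≤ D * wnorm (-q) ξ.seq := by
    classical
    clear hC
    induction s using Finset.induction_on with
    | empty => exact ⟨0, le_rfl, fun ξ _ => by simp⟩
    | insert a s _ ih =>
      obtain ⟨D, hD, h⟩ := ih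
      obtain ⟨E, hE⟩ := a.2 q
      refine ⟨max D E, hD.trans (le_max_left _ _), fun ξ hξ => ?_⟩
      rw [Finset.sup_insert, Seminorm.sup_apply]
      refine max_le ((hE ξ hξ).trans ?_) ((h ξ hξ).trans ?_)
      · exact mul_le_mul_of_nonneg_right (le_max_right _ _) (wnorm_nonneg _ _)
      · exact mul_le_mul_of_nonneg_right (le_max_left _ _) (wnorm_nonneg _ _)
  obtain ⟨D, hD, h⟩ := key
  refine ⟨C * D, by positivity, fun ξ hξ => (hC ξ).trans ?_⟩
  rw [mul_assoc]
  exact mul_le_mul_of_nonneg_left (h ξ hξ) C.2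

/-- A linear map out of `s'` is continuous if it is so on every step. -/
lemma continuous_of_step {E : Type*} [AddCommGroup E] [Module ℂ E] [TopologicalSpace E]
    {ι : Type*} {p : SeminormFamily ℂ E ι} (hp : WithSeminorms p) (f : SlowSeq →ₗ[ℂ] E)
    (h : ∀ i, ∀ q : ℕ, ∃ C : ℝ, ∀ ξ : SlowSeq, WSum (-q) ξ.seq → p i (f ξ) ≤ C * wnorm (-q) ξ.seq) :
    Continuous f := by
  refine withSeminorms_slow.continuous_of_isBounded hp f fun i => ?_
  refine ⟨{⟨(p i).comp f, h i⟩}, 1, ?_⟩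
  rw [Finset.sup_singleton, one_smul]
  exact le_rfl

/-- The inclusion of `s` into `s'`, as a linear map. -/
def inclLin : RapidSeq →ₗ[ℂ] SlowSeq where
  toFun ξ := SlowSeq.mk ξ.seq ⟨0, (ξ.wsum 0).mono (by simp)⟩
  map_add' _ _ := rfl
  map_smul' _ _ := rfl

lemma inclLin_bounded : Seminorm.IsBounded rapidNorm slowSeminorms inclLin := by
  intro p
  obtain ⟨C, hC⟩ := p.2 0
  refine ⟨{0}, Real.toNNReal C, fun ξ => ?_⟩
  rw [Finset.sup_singleton]
  have h1 := hC (inclLin ξ) ((ξ.wsum 0).mono (by simp))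
  have h2 : wnorm (-((0 : ℕ) : ℤ)) (inclLin ξ).seq = wnorm ((0 : ℕ) : ℤ) ξ.seq := by
    rw [Nat.cast_zero, neg_zero]
    rfl
  rw [h2] at h1
  rw [_root_.smul_apply, NNReal.smul_def, rapidNorm_apply, Seminorm.comp_apply]
  exact h1.trans (mul_le_mul_of_nonneg_right (Real.le_coe_toNNReal C) (wnorm_nonneg _ _))

/-- The canonical continuous inclusion of `s` into `s'`. -/
def incl : RapidSeq →L[ℂ] SlowSeq :=
  ⟨inclLin, withSeminorms_rapid.continuous_of_isBounded withSeminorms_slow _ inclLin_bounded⟩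

lemma seq_incl (ξ : RapidSeq) : (incl ξ).seq = ξ.seq := rfl

lemma wsum_zero_l2 (f : L2) : WSum 0 f := by
  rw [wsum_iff]
  simpa using lp.memℓp f

lemma wnorm_zero_l2 (f : L2) : wnorm 0 f = ‖f‖ := by
  rw [← norm_weighted 0 _ (wsum_zero_l2 f)]
  congr 1
  ext j
  simp [weighted]

/-- The inclusion of `ℓ₂` into `s'`, as a linear map. -/
def ofL2Lin : L2 →ₗ[ℂ] SlowSeq where
  toFun f := SlowSeq.mk f ⟨0, (wsum_zero_l2 f).mono (by simp)⟩
  map_add' _ _ := rfl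
  map_smul' _ _ := rfl

lemma ofL2Lin_bounded :
    Seminorm.IsBounded (fun _ : Fin 1 => normSeminorm ℂ L2) slowSeminorms ofL2Lin := by
  intro p
  obtain ⟨C, hC⟩ := p.2 0
  refine ⟨{0}, Real.toNNReal C, fun f => ?_⟩
  rw [Finset.sup_singleton]
  have h1 := hC (ofL2Lin f) ((wsum_zero_l2 f).mono (by simp))
  have h2 : wnorm (-((0 : ℕ) : ℤ)) (ofL2Lin f).seq = ‖f‖ := by
    rw [Nat.cast_zero, neg_zero]
    exact wnorm_zero_l2 f
  rw [h2] at h1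
  rw [_root_.smul_apply, NNReal.smul_def, coe_normSeminorm, Seminorm.comp_apply]
  exact h1.trans (mul_le_mul_of_nonneg_right (Real.le_coe_toNNReal C) (norm_nonneg _))

/-- The canonical continuous inclusion of `ℓ₂` into `s'`. -/
def ofL2 : L2 →L[ℂ] SlowSeq :=
  ⟨ofL2Lin, (norm_withSeminorms ℂ L2).continuous_of_isBounded withSeminorms_slow _ ofL2Lin_bounded⟩

lemma seq_ofL2 (f : L2) : (ofL2 f).seq = f := rfl

lemma memℓp_rapid (ξ : RapidSeq) : Memℓp ξ.seq 2 := by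
  have := (wsum_iff 0 ξ.seq).1 (ξ.wsum 0)
  simpa using this

/-- The inclusion of `s` into `ℓ₂`, as a linear map. -/
def intoL2Lin : RapidSeq →ₗ[ℂ] L2 where
  toFun ξ := ⟨ξ.seq, memℓp_rapid ξ⟩
  map_add' _ _ := rfl
  map_smul' _ _ := rfl

lemma intoL2Lin_bounded :
    Seminorm.IsBounded rapidNorm (fun _ : Fin 1 => normSeminorm ℂ L2) intoL2Lin := by
  intro _
  refine ⟨{0}, 1, fun ξ => ?_⟩
  rw [Finset.sup_singleton, one_smul]
  exact (wnorm_zero_l2 (intoL2Lin ξ)).symm.le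

/-- The canonical continuous inclusion of `s` into `ℓ₂`. -/
def intoL2 : RapidSeq →L[ℂ] L2 :=
  ⟨intoL2Lin,
    withSeminorms_rapid.continuous_of_isBounded (norm_withSeminorms ℂ L2) _ intoL2Lin_bounded⟩

lemma intoL2_apply (ξ : RapidSeq) (j : ℕ+) : intoL2 ξ j = ξ.seq j := rfl

/-! ## The algebra `L(s', s)` -/

/-- The continuous linear operators from `s'` to `s`. -/
def SmoothOp : Type := SlowSeq →L[ℂ] RapidSeq

namespace SmoothOp

instance : AddCommGroup SmoothOp := inferInstanceAs (AddCommGroup (SlowSeq →L[ℂ] RapidSeq))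
instance : Module ℂ SmoothOp := inferInstanceAs (Module ℂ (SlowSeq →L[ℂ] RapidSeq))

/-- An element of `L(s', s)` as a continuous linear map. -/
def toCLM : SmoothOp →ₗ[ℂ] (SlowSeq →L[ℂ] RapidSeq) := LinearMap.id

/-- The multiplication of `L(s', s)`: composition, through the inclusion of `s` into `s'`. -/
instance : Mul SmoothOp := ⟨fun x y => (x.toCLM.comp (incl.comp y.toCLM) : SlowSeq →L[ℂ] RapidSeq)⟩

lemma mul_apply (x y : SmoothOp) (ξ : SlowSeq) :
    (x * y).toCLM ξ = x.toCLM (incl (y.toCLM ξ)) := rfl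

lemma ext' {x y : SmoothOp} (h : ∀ ξ, x.toCLM ξ = y.toCLM ξ) : x = y :=
  ContinuousLinearMap.ext h

instance : NonUnitalRing SmoothOp where
  left_distrib x y z := ext' fun ξ => by simp [mul_apply]
  right_distrib x y z := ext' fun ξ => by simp [mul_apply]
  zero_mul x := ext' fun ξ => by simp [mul_apply]
  mul_zero x := ext' fun ξ => by simp [mul_apply]
  mul_assoc x y z := ext' fun ξ => by simp [mul_apply]

instance : IsScalarTower ℂ SmoothOp SmoothOp :=
  ⟨fun c x y => ext' fun ξ => by simp [mul_apply]⟩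

instance : SMulCommClass ℂ SmoothOp SmoothOp :=
  ⟨fun c x y => ext' fun ξ => by simp [mul_apply]⟩

/-- The embedding of `L(s', s)` into `L(ℓ₂)`, by `ℓ₂ → s' → s → ℓ₂`. -/
def toL2 : SmoothOp →ₗ[ℂ] (L2 →L[ℂ] L2) where
  toFun x := intoL2.comp (x.toCLM.comp ofL2)
  map_add' x y := by ext; simp
  map_smul' c x := by ext; simp

lemma bound (x : SmoothOp) (p q : ℕ) : ∃ C : ℝ, 0 ≤ C ∧ ∀ ξ : SlowSeq, WSum (-q) ξ.seq →
    wnorm p (x.toCLM ξ).seq ≤ C * wnorm (-q) ξ.seq :=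
  stepBound_of_continuous ((rapidNorm p).comp x.toCLM.toLinearMap)
    ((withSeminorms_rapid.continuous_seminorm p).comp x.toCLM.continuous) q

/-- `{|xξ|_q : |ξ|'_q ≤ 1}` -/
def normSet (q : ℕ) (x : SmoothOp) : Set ℝ :=
  {t | ∃ ξ : SlowSeq, WSum (-q) ξ.seq ∧ wnorm (-q) ξ.seq ≤ 1 ∧ t = wnorm q (x.toCLM ξ).seq}

lemma normSet_nonempty (q : ℕ) (x : SmoothOp) : (normSet q x).Nonempty :=
  ⟨_, 0, by rw [map_zero]; exact WSum.zero _, by rw [map_zero, wnorm_zero]; exact zero_le_one, rfl⟩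

lemma normSet_bddAbove (q : ℕ) (x : SmoothOp) : BddAbove (normSet q x) := by
  obtain ⟨C, hC, h⟩ := x.bound q q
  refine ⟨C, ?_⟩
  rintro _ ⟨ξ, hξ, h1, rfl⟩
  exact (h ξ hξ).trans (mul_le_of_le_one_right hC h1)

lemma sSup_normSet_nonneg (q : ℕ) (x : SmoothOp) : 0 ≤ sSup (normSet q x) :=
  Real.sSup_nonneg (by rintro _ ⟨ξ, -, -, rfl⟩; exact wnorm_nonneg _ _)

/-- The norms `‖x‖_q = sup {|xξ|_q : |ξ|'_q ≤ 1}` of `L(s', s)`. -/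
def opNorm : SeminormFamily ℂ SmoothOp ℕ := fun q =>
  Seminorm.ofSMulLE (fun x => sSup (normSet q x))
    (le_antisymm (csSup_le (normSet_nonempty q 0) (by
      rintro _ ⟨ξ, -, -, rfl⟩
      simp [wnorm_zero])) (sSup_normSet_nonneg q 0))
    (fun x y => csSup_le (normSet_nonempty q _) (by
      rintro _ ⟨ξ, h, h1, rfl⟩
      rw [map_add, add_apply, map_add]
      exact (wnorm_add_le (RapidSeq.wsum _ q) (RapidSeq.wsum _ q)).trans
        (add_le_add (le_csSup (normSet_bddAbove q x) ⟨ξ, h, h1, rfl⟩)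
          (le_csSup (normSet_bddAbove q y) ⟨ξ, h, h1, rfl⟩))))
    (fun c x => csSup_le (normSet_nonempty q _) (by
      rintro _ ⟨ξ, h, h1, rfl⟩
      rw [map_smul, smul_apply, map_smul, wnorm_smul]
      exact mul_le_mul_of_nonneg_left (le_csSup (normSet_bddAbove q x) ⟨ξ, h, h1, rfl⟩)
        (norm_nonneg c)))

lemma opNorm_apply (q : ℕ) (x : SmoothOp) : opNorm q x = sSup (normSet q x) := rfl

/-- The Fréchet topology of `L(s', s)`. -/
instance : TopologicalSpace SmoothOp := opNorm.moduleFilterBasis.topology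

lemma withSeminorms_opNorm : WithSeminorms opNorm := ⟨rfl⟩

/-- The canonical unit sequences in `s'`. -/
def unitSlow (k : ℕ+) : SlowSeq := SlowSeq.mk (unitSeq k) ⟨0, wsum_unitSeq _ _⟩

/-- The entry `⟨x e_k, e_j⟩` of the matrix of `x`. -/
def entry (x : SmoothOp) (j k : ℕ+) : ℂ := (x.toCLM (unitSlow k)).seq j

lemma hasSum_apply (x : SmoothOp) (ξ : SlowSeq) (j : ℕ+) :
    HasSum (fun k => ξ.seq k * x.entry j k) ((x.toCLM ξ).seq j) := by
  obtain ⟨q, hq⟩ := ξ.wsum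
  obtain ⟨C, hC, hb⟩ := x.bound 0 q
  rw [HasSum, SummationFilter.unconditional_filter, tendsto_iff_norm_sub_tendsto_zero]
  have hlim := (tendsto_section (-q) ξ.seq).const_mul C
  rw [mul_zero] at hlim
  refine squeeze_zero (fun _ => norm_nonneg _) (fun F => ?_) hlim
  set ζ : SlowSeq := ξ - ∑ k ∈ F, ξ.seq k • unitSlow k with hζ
  have hseq : ζ.seq = ξ.seq - ∑ k ∈ F, ξ.seq k • unitSeq k := by
    rw [hζ, map_sub, map_sum]
    simp only [map_smul]
    rfl
  have h1 : (x.toCLM ζ).seq j = (x.toCLM ξ).seq j - ∑ k ∈ F, ξ.seq k * x.entry j k := by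
    rw [hζ, map_sub, map_sum, map_sub, map_sum, Pi.sub_apply, Finset.sum_apply]
    simp only [map_smul]
    rfl
  have hw : WSum (-q) ζ.seq := by
    rw [hseq]
    refine hq.sub ?_
    refine Finset.sum_induction _ (WSum (-q)) (fun _ _ => WSum.add) (WSum.zero _) fun k _ => ?_
    exact (wsum_unitSeq _ _).smul _
  rw [norm_sub_rev, ← h1, ← hseq]
  refine le_trans ?_ (hb ζ hw)
  simpa using norm_le_wnorm ((x.toCLM ζ).wsum 0) j

lemma ext_entry {x y : SmoothOp} (h : ∀ j k, x.entry j k = y.entry j k) : x = y :=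
  ext' fun ξ => RapidSeq.ext <| funext fun j =>
    (x.hasSum_apply ξ j).unique (by simpa only [h] using y.hasSum_apply ξ j)

/-- The sequence `(⟨ξ, x e_j⟩)_j`. -/
def adjSeq (x : SmoothOp) (ξ : ℕ+ → ℂ) : ℕ+ → ℂ := fun j => ∑' k, ξ k * star (x.entry k j)

lemma adj_bound (x : SmoothOp) (p q : ℕ) : ∃ C : ℝ, ∀ ξ : ℕ+ → ℂ, WSum (-q) ξ →
    WSum p (x.adjSeq ξ) ∧ wnorm p (x.adjSeq ξ) ≤ C * wnorm (-q) ξ := by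
  obtain ⟨C, hC, hb⟩ := x.bound q (p + 1)
  have key : ∀ ξ : ℕ+ → ℂ, WSum (-q) ξ → ∀ j : ℕ+, ‖x.adjSeq ξ j‖ ^ 2 * (j : ℝ) ^ (2 * (p : ℤ)) ≤
      (wnorm (-q) ξ * C) ^ 2 * ((j : ℝ) ^ 2)⁻¹ := by
    intro ξ hξ j
    have hj := pnat_pos j
    have h1 := (pairing hξ (η := (x.toCLM (unitSlow j)).seq)
      (by rw [neg_neg]; exact RapidSeq.wsum _ q)).2
    rw [neg_neg] at h1
    have h2 := hb (unitSlow j) (wsum_unitSeq _ _)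
    have h3 : wnorm (-((p + 1 : ℕ) : ℤ)) (unitSlow j).seq = (j : ℝ) ^ (-((p + 1 : ℕ) : ℤ)) :=
      wnorm_unitSeq _ _
    rw [h3] at h2
    have h4 : ‖x.adjSeq ξ j‖ ≤ wnorm (-q) ξ * C * (j : ℝ) ^ (-((p + 1 : ℕ) : ℤ)) := by
      rw [mul_assoc]
      exact h1.trans (mul_le_mul_of_nonneg_left h2 (wnorm_nonneg _ _))
    calc ‖x.adjSeq ξ j‖ ^ 2 * (j : ℝ) ^ (2 * (p : ℤ))
        ≤ (wnorm (-q) ξ * C * (j : ℝ) ^ (-((p + 1 : ℕ) : ℤ))) ^ 2 * (j : ℝ) ^ (2 * (p : ℤ)) := by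
          gcongr
      _ = (wnorm (-q) ξ * C) ^ 2 * ((j : ℝ) ^ 2)⁻¹ := by
          rw [mul_pow, mul_assoc]
          congr 1
          rw [← zpow_natCast, ← zpow_mul, ← zpow_add₀ hj.ne', ← zpow_natCast, ← zpow_neg]
          congr 1
          push_cast
          ring
  have hS : Summable fun j : ℕ+ => ((j : ℝ) ^ 2)⁻¹ := by
    have := (Real.summable_nat_pow_inv (p := 2)).2 (by norm_num)
    exact this.comp_injective PNat.coe_injective
  refine ⟨C * Real.sqrt (∑' j : ℕ+, ((j : ℝ) ^ 2)⁻¹), fun ξ hξ => ?_⟩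
  have hw : WSum p (x.adjSeq ξ) := Summable.of_nonneg_of_le
    (fun j => by have := pnat_pos j; positivity) (key ξ hξ) (hS.mul_left _)
  refine ⟨hw, ?_⟩
  have h5 := Summable.tsum_le_tsum (key ξ hξ) hw (hS.mul_left _)
  rw [tsum_mul_left] at h5
  refine (Real.sqrt_le_sqrt h5).trans (le_of_eq ?_)
  rw [Real.sqrt_mul (sq_nonneg _), Real.sqrt_sq (mul_nonneg (wnorm_nonneg _ _) hC)]
  ring

lemma summable_adj (x : SmoothOp) (ξ : SlowSeq) (j : ℕ+) :
    Summable fun k => ξ.seq k * star (x.entry k j) := by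
  obtain ⟨q, hq⟩ := ξ.wsum
  exact (pairing hq (η := (x.toCLM (unitSlow j)).seq)
      (by rw [neg_neg]; exact RapidSeq.wsum _ q)).1

/-- `ξ ↦ (⟨ξ, x e_j⟩)_j`, as a linear map. -/
def adjLin (x : SmoothOp) : SlowSeq →ₗ[ℂ] RapidSeq where
  toFun ξ := RapidSeq.mk (x.adjSeq ξ.seq) fun p => by
    obtain ⟨q, hq⟩ := ξ.wsum
    obtain ⟨C, h⟩ := x.adj_bound p q
    exact (h _ hq).1
  map_add' ξ η := RapidSeq.ext <| funext fun j => by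
    change x.adjSeq (ξ + η).seq j = x.adjSeq ξ.seq j + x.adjSeq η.seq j
    rw [adjSeq, adjSeq, adjSeq, ← (x.summable_adj ξ j).tsum_add (x.summable_adj η j)]
    refine tsum_congr fun k => ?_
    rw [map_add, Pi.add_apply, add_mul]
  map_smul' c ξ := RapidSeq.ext <| funext fun j => by
    change x.adjSeq (c • ξ).seq j = c * x.adjSeq ξ.seq j
    rw [adjSeq, adjSeq, ← tsum_mul_left]
    refine tsum_congr fun k => ?_
    rw [map_smul, Pi.smul_apply, smul_eq_mul, mul_assoc]

lemma adjLin_apply (x : SmoothOp) (ξ : SlowSeq) (j : ℕ+) :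
    (x.adjLin ξ).seq j = ∑' k, ξ.seq k * star (x.entry k j) := rfl

lemma continuous_adjLin (x : SmoothOp) : Continuous x.adjLin :=
  continuous_of_step withSeminorms_rapid x.adjLin fun p q => by
    obtain ⟨C, h⟩ := x.adj_bound p q
    exact ⟨C, fun ξ hξ => (h _ hξ).2⟩

/-- The involution of `L(s', s)`: the adjoint `x*`, given by `(x* ξ)_j = ⟨ξ, x e_j⟩`; it is the
Hilbert space adjoint on `ℓ₂`, see `toL2_star`. -/
instance : Star SmoothOp := ⟨fun x => (⟨x.adjLin, x.continuous_adjLin⟩ : SlowSeq →L[ℂ] RapidSeq)⟩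

lemma star_apply (x : SmoothOp) (ξ : SlowSeq) (j : ℕ+) :
    ((star x).toCLM ξ).seq j = ∑' k, ξ.seq k * star (x.entry k j) := rfl

lemma entry_star (x : SmoothOp) (j k : ℕ+) : (star x).entry j k = star (x.entry k j) := by
  rw [entry, star_apply, tsum_eq_single k]
  · have : (unitSlow k).seq k = 1 := by simp [unitSlow, SlowSeq.seq_mk, unitSeq]
    rw [this, one_mul]
  · intro l hl
    have : (unitSlow k).seq l = 0 := by simp [unitSlow, SlowSeq.seq_mk, unitSeq, hl]
    rw [this, zero_mul]

lemma hasSum_entry_mul (x y : SmoothOp) (j k : ℕ+) :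
    HasSum (fun l => x.entry j l * y.entry l k) ((x * y).entry j k) := by
  have := x.hasSum_apply (incl (y.toCLM (unitSlow k))) j
  simp only [mul_comm (x.entry j _)]
  exact this

instance : StarRing SmoothOp where
  star_involutive x := ext_entry fun j k => by rw [entry_star, entry_star, star_star]
  star_mul x y := ext_entry fun j k => by
    refine HasSum.unique ?_ (hasSum_entry_mul (star y) (star x) j k)
    rw [entry_star]
    have := (hasSum_entry_mul x y k j).star
    refine this.congr_fun fun l => ?_
    rw [entry_star, entry_star, star_mul', mul_comm]
  star_add x y := ext_entry fun j k => by
    rw [entry_star]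
    change star (x.entry k j + y.entry k j) = (star x).entry j k + (star y).entry j k
    rw [star_add, entry_star, entry_star]

instance : StarModule ℂ SmoothOp where
  star_smul c x := ext_entry fun j k => by
    rw [entry_star]
    change star (c * x.entry k j) = star c * (star x).entry j k
    rw [entry_star, star_mul']

lemma toL2_apply (x : SmoothOp) (f : L2) (j : ℕ+) : x.toL2 f j = (x.toCLM (ofL2 f)).seq j := rfl

lemma toL2_mul (x y : SmoothOp) : (x * y).toL2 = x.toL2 * y.toL2 := rfl

lemma toL2_injective : Function.Injective toL2 := by
  intro x y h
  refine ext_entry fun j k => ?_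
  have h1 := congrArg (fun T : L2 →L[ℂ] L2 => T (lp.single 2 k 1) j) h
  have h2 : ofL2 (lp.single 2 k 1) = unitSlow k := by
    refine SlowSeq.ext ?_
    rw [seq_ofL2, lp.coeFn_single]
    rfl
  simp only [toL2_apply, h2] at h1
  exact h1

lemma toL2_star (x : SmoothOp) : (star x).toL2 = ContinuousLinearMap.adjoint x.toL2 := by
  ext f j
  have h2 : ofL2 (lp.single 2 j 1) = unitSlow j := by
    refine SlowSeq.ext ?_
    rw [seq_ofL2, lp.coeFn_single]
    rfl
  have h3 := lp.inner_single_left (𝕜 := ℂ) j (1 : ℂ) (ContinuousLinearMap.adjoint x.toL2 f)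
  rw [ContinuousLinearMap.adjoint_inner_right, lp.inner_eq_tsum] at h3
  simp only [RCLike.inner_apply, map_one, mul_one, toL2_apply, h2] at h3
  rw [← h3]
  rfl

end SmoothOp

/-- `x = ∑ λ_n P_n` is a spectral representation of `x ∈ L(s', s)`: the `λ_n` are nonzero, pairwise
different, with decreasing moduli, the `P_n` are nonzero, finite dimensional, pairwise orthogonal
(self-adjoint) projections on `ℓ₂`, and the series converges to `x` in the norm of `L(ℓ₂)`. It is
not assumed that the `P_n` belong to `L(s', s)`, nor that the series converges there. The spectral
sequences are indexed from `0`. -/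
structure IsSpectralRepresentation (x : SmoothOp) (lam : ℕ → ℂ) (P : ℕ → (L2 →L[ℂ] L2)) :
    Prop where
  lam_ne_zero : ∀ n, lam n ≠ 0
  lam_injective : Function.Injective lam
  lam_antitone : Antitone fun n => ‖lam n‖
  proj : ∀ n, IsStarProjection (P n)
  proj_ne_zero : ∀ n, P n ≠ 0
  proj_finite : ∀ n, FiniteDimensional ℂ (P n).range
  proj_orthogonal : ∀ m n, m ≠ n → P m * P n = 0
  tendsto_sum : Tendsto (fun N : ℕ => ∑ n ∈ Finset.range N, lam n • P n) atTop (𝓝 x.toL2)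

end SmoothOperators

end

namespace SmoothOperators

/-! Both directions pass from the norm of `L(ℓ₂)` to the finer topology of `L(s', s)`, each by its
own device.

For `⇐`, the remainder `r_N = x - ∑_{n<N} λ_n P_n` equals `x E_N = E_N x` with the projection `E_N =
1 - ∑_{n<N} P_n`. Hence `‖r_N e_k‖ ≤ ‖x e_k‖` and `‖r_N* e_k‖ ≤ ‖x* e_k‖`: the columns and rows of
`r_N` decay rapidly, uniformly in `N`, while `‖r_N‖ → 0`. Interpolating entry by entry
(`opNorm_le_of_dominated`) gives convergence of the series in every norm of `L(s', s)`
(`tendsto_sum_smooth`).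

For `⇒`, `P_n = x (λ_n⁻² P_n) x` is smooth, and `B ↦ x B x` is continuous from `L(ℓ₂)` to `L(s', s)`
(`opNorm_sandwich_le`). Choose `N > n` with `‖x E_N‖ < |λ_n|` and a polynomial `u` in `x` without
constant term that acts as `1` on `P_n` and as `0` on the other `P_m`, `m < N`
(`exists_separating`). With `M = x / λ_n`, the powers of `M` fix `P_n` and decay geometrically on
the range of `E_N`, so `u M^k → P_n` in operator norm; one more factor `M` on each side turns this
into convergence in `L(s', s)`. The factor `u` is needed because powers of `M` alone do not damp
other eigenvalues of modulus at least `|λ_n|`. -/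

/-! ### Matrix entries and the norms of `L(s', s)` -/

lemma summable_pnat_sq_inv : Summable fun j : ℕ+ => ((j : ℝ) ^ 2)⁻¹ :=
  ((Real.summable_nat_pow_inv (p := 2)).2 (by norm_num)).comp_injective PNat.coe_injective

/-- A pointwise bound by `c j^{-(q+1)}` bounds the weighted norm `wnorm q`. -/
lemma wnorm_le_of_pointwise {q : ℤ} {ξ : ℕ+ → ℂ} {c : ℝ} (hc : 0 ≤ c)
    (h : ∀ j, ‖ξ j‖ ≤ c * (j : ℝ) ^ (-(q + 1))) :
    WSum q ξ ∧ wnorm q ξ ≤ c * Real.sqrt (∑' j : ℕ+, ((j : ℝ) ^ 2)⁻¹) := by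
  have key : ∀ j : ℕ+, ‖ξ j‖ ^ 2 * (j : ℝ) ^ (2 * q) ≤ c ^ 2 * ((j : ℝ) ^ 2)⁻¹ := by
    intro j
    have hj := pnat_pos j
    -- The extra power of `j` in the hypothesis leaves the summable weight `j⁻²`.
    calc ‖ξ j‖ ^ 2 * (j : ℝ) ^ (2 * q)
        ≤ (c * (j : ℝ) ^ (-(q + 1))) ^ 2 * (j : ℝ) ^ (2 * q) := by
          gcongr
          exact h j
      _ = c ^ 2 * ((j : ℝ) ^ 2)⁻¹ := by
          rw [mul_pow, mul_assoc]
          congr 1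
          rw [← zpow_natCast, ← zpow_mul, ← zpow_add₀ hj.ne', ← zpow_natCast, ← zpow_neg]
          congr 1
          push_cast
          ring
  have hw : WSum q ξ := Summable.of_nonneg_of_le
    (fun j => by have := pnat_pos j; positivity) key (summable_pnat_sq_inv.mul_left _)
  refine ⟨hw, ?_⟩
  have h5 := Summable.tsum_le_tsum key hw (summable_pnat_sq_inv.mul_left _)
  rw [tsum_mul_left] at h5
  refine (Real.sqrt_le_sqrt h5).trans (le_of_eq ?_)
  rw [Real.sqrt_mul (sq_nonneg _), Real.sqrt_sq hc]

/-- The canonical unit vectors of `ℓ₂`. -/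
noncomputable def unitL2 (k : ℕ+) : L2 := lp.single 2 k 1

lemma norm_unitL2 (k : ℕ+) : ‖unitL2 k‖ = 1 := by
  rw [unitL2, lp.norm_single (by norm_num), norm_one]

lemma ofL2_unitL2 (k : ℕ+) : ofL2 (unitL2 k) = SmoothOp.unitSlow k :=
  SlowSeq.ext (by rw [seq_ofL2, unitL2, lp.coeFn_single]; rfl)

namespace SmoothOp

lemma entry_eq_toL2 (x : SmoothOp) (j k : ℕ+) : x.entry j k = x.toL2 (unitL2 k) j := by
  rw [toL2_apply, ofL2_unitL2]
  rfl

lemma norm_entry_le (x : SmoothOp) (j k : ℕ+) : ‖x.entry j k‖ ≤ ‖x.toL2 (unitL2 k)‖ := by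
  rw [entry_eq_toL2]
  exact lp.norm_apply_le_norm (by norm_num) _ j

lemma norm_entry_le' (x : SmoothOp) (j k : ℕ+) :
    ‖x.entry j k‖ ≤ ‖(star x).toL2 (unitL2 j)‖ := by
  rw [← norm_star, ← entry_star]
  exact norm_entry_le _ _ _

/-- The images of the unit vectors decrease rapidly. -/
lemma norm_toL2_unitL2_le (x : SmoothOp) (m : ℕ) : ∃ C : ℝ, 0 ≤ C ∧ ∀ k : ℕ+,
    ‖x.toL2 (unitL2 k)‖ ≤ C * (k : ℝ) ^ (-(m : ℤ)) := by
  obtain ⟨C, hC, hb⟩ := x.bound 0 m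
  refine ⟨C, hC, fun k => ?_⟩
  have h := hb (unitSlow k) (wsum_unitSeq _ _)
  have h3 : wnorm (-(m : ℤ)) (unitSlow k).seq = (k : ℝ) ^ (-(m : ℤ)) := wnorm_unitSeq _ _
  rw [h3, ← ofL2_unitL2] at h
  rw [← wnorm_zero_l2]
  exact h

/-- Rapid decrease of the matrix entries bounds the norms of `L(s', s)`. -/
lemma opNorm_le_of_entry (x : SmoothOp) (q : ℕ) {c : ℝ} (hc : 0 ≤ c)
    (h : ∀ j k : ℕ+, ‖x.entry j k‖ ≤
      c * (j : ℝ) ^ (-((q : ℤ) + 1)) * (k : ℝ) ^ (-((q : ℤ) + 1))) :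
    opNorm q x ≤ c * ∑' j : ℕ+, ((j : ℝ) ^ 2)⁻¹ := by
  set K := ∑' j : ℕ+, ((j : ℝ) ^ 2)⁻¹ with hK
  have hK0 : 0 ≤ K := tsum_nonneg fun j => by positivity
  rw [opNorm_apply]
  refine csSup_le (normSet_nonempty q x) ?_
  rintro _ ⟨ξ, hξ, h1, rfl⟩
  have hrow : ∀ j : ℕ+, ‖(x.toCLM ξ).seq j‖ ≤
      (c * Real.sqrt K) * (j : ℝ) ^ (-((q : ℤ) + 1)) := by
    intro j
    have hj := pnat_pos j
    -- The `j`-th entry of `x ξ` is the pairing of `ξ` with the conjugated `j`-th row, so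
    -- Cauchy-Schwarz applies; each of the two summations, over `k` here and over `j` below, costs
    -- one factor `√K`.
    obtain ⟨hw, hn⟩ := wnorm_le_of_pointwise (q := q) (ξ := fun k => star (x.entry j k))
      (c := c * (j : ℝ) ^ (-((q : ℤ) + 1))) (by positivity)
      (fun k => by rw [norm_star]; exact h j k)
    have hp := (pairing hξ (η := fun k => star (x.entry j k)) (by rwa [neg_neg])).2
    simp only [star_star, neg_neg] at hp
    rw [(x.hasSum_apply ξ j).tsum_eq] at hp
    calc ‖(x.toCLM ξ).seq j‖ ≤ _ := hp
      _ ≤ 1 * (c * (j : ℝ) ^ (-((q : ℤ) + 1)) * Real.sqrt K) :=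
          mul_le_mul h1 hn (wnorm_nonneg _ _) zero_le_one
      _ = _ := by ring
  refine (wnorm_le_of_pointwise (by positivity) hrow).2.trans (le_of_eq ?_)
  rw [mul_assoc, Real.mul_self_sqrt hK0]

/-- Domination on the unit vectors, on both sides, by a fixed element of `L(s', s)` turns smallness
in the operator norm of `L(ℓ₂)` into smallness in `L(s', s)`. -/
lemma opNorm_le_of_dominated (x : SmoothOp) (q : ℕ) : ∃ C : ℝ, 0 ≤ C ∧ ∀ r : SmoothOp,
    (∀ k, ‖r.toL2 (unitL2 k)‖ ≤ ‖x.toL2 (unitL2 k)‖) →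
    (∀ k, ‖(star r).toL2 (unitL2 k)‖ ≤ ‖(star x).toL2 (unitL2 k)‖) →
    opNorm q r ≤ C * Real.sqrt ‖r.toL2‖ := by
  -- Decay of order `4(q+1)` is requested because a fourth root is taken at the end.
  obtain ⟨C, hC, hb⟩ := norm_toL2_unitL2_le x (4 * (q + 1))
  obtain ⟨D, hD, hd⟩ := norm_toL2_unitL2_le (star x) (4 * (q + 1))
  have hK0 : 0 ≤ ∑' j : ℕ+, ((j : ℝ) ^ 2)⁻¹ := tsum_nonneg fun j => by positivity
  refine ⟨Real.sqrt (Real.sqrt (C * D)) * ∑' j : ℕ+, ((j : ℝ) ^ 2)⁻¹, by positivity,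
    fun r hr hr' => ?_⟩
  refine (opNorm_le_of_entry r q (c := Real.sqrt (Real.sqrt (C * D)) * Real.sqrt ‖r.toL2‖)
    (by positivity) fun j k => ?_).trans (le_of_eq (by ring))
  have hj := pnat_pos j
  have hk := pnat_pos k
  have e0 : ‖r.entry j k‖ ≤ ‖r.toL2‖ := by
    refine (norm_entry_le r j k).trans ((r.toL2.le_opNorm _).trans (le_of_eq ?_))
    rw [norm_unitL2, mul_one]
  have e1 := ((norm_entry_le r j k).trans (hr k)).trans (hb k)
  have e2 := ((norm_entry_le' r j k).trans (hr' j)).trans (hd j)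
  have hpow : ∀ l : ℕ+, (l : ℝ) ^ (-((4 * (q + 1) : ℕ) : ℤ)) =
      ((l : ℝ) ^ (-((q : ℤ) + 1))) ^ 4 := by
    intro l
    rw [← zpow_natCast, ← zpow_mul]
    congr 1
    push_cast
    ring
  rw [hpow] at e1 e2
  -- Interpolation: of the four factors `|r_jk|`, two are bounded by the operator norm, one by the
  -- column bound and one by the row bound.
  refine le_of_pow_le_pow_left₀ (n := 4) (by norm_num) (by positivity) ?_
  have h4 : Real.sqrt (Real.sqrt (C * D)) ^ 4 = C * D := by
    rw [show 4 = 2 * 2 from rfl, pow_mul, Real.sq_sqrt (by positivity),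
      Real.sq_sqrt (by positivity)]
  have h4' : Real.sqrt ‖r.toL2‖ ^ 4 = ‖r.toL2‖ ^ 2 := by
    rw [show 4 = 2 * 2 from rfl, pow_mul, Real.sq_sqrt (norm_nonneg _)]
  calc ‖r.entry j k‖ ^ 4 = ‖r.entry j k‖ ^ 2 * (‖r.entry j k‖ * ‖r.entry j k‖) := by ring
    _ ≤ ‖r.toL2‖ ^ 2 * ((C * ((k : ℝ) ^ (-((q : ℤ) + 1))) ^ 4) *
        (D * ((j : ℝ) ^ (-((q : ℤ) + 1))) ^ 4)) := by gcongr
    _ = _ := by rw [mul_pow, mul_pow, mul_pow, h4, h4']; ring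

/-! ### Continuity of `B ↦ x B x` -/

/-- The operator `x B x` of `L(s', s)`, for a bounded operator `B` on `ℓ₂`. -/
noncomputable def sandwich (x : SmoothOp) (B : L2 →L[ℂ] L2) : SmoothOp :=
  (x.toCLM.comp (ofL2.comp (B.comp (intoL2.comp x.toCLM))) : SlowSeq →L[ℂ] RapidSeq)

lemma toL2_sandwich (x : SmoothOp) (B : L2 →L[ℂ] L2) :
    (x.sandwich B).toL2 = x.toL2 * B * x.toL2 := rfl

/-- The right factor `x` maps the unit ball of `|·|'_q` boundedly into `ℓ₂`, and the left factor
maps `ℓ₂` boundedly into `s` with the norm `|·|_q`; between them only the `ℓ₂` operator norm of `B`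
matters. -/
lemma opNorm_sandwich_le (x : SmoothOp) (q : ℕ) :
    ∃ C : ℝ, ∀ B : L2 →L[ℂ] L2, opNorm q (x.sandwich B) ≤ C * ‖B‖ := by
  obtain ⟨C, hC, hb⟩ := x.bound q 0
  obtain ⟨D, hD, hd⟩ := x.bound 0 q
  refine ⟨C * D, fun B => ?_⟩
  rw [opNorm_apply]
  refine csSup_le (normSet_nonempty q _) ?_
  rintro _ ⟨ξ, hξ, h1, rfl⟩
  set f : L2 := intoL2 (x.toCLM ξ) with hf
  have hfn : ‖f‖ ≤ D := by
    rw [← wnorm_zero_l2]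
    exact (hd ξ hξ).trans (mul_le_of_le_one_right hD h1)
  have h2 := hb (ofL2 (B f)) ((wsum_zero_l2 (B f)).mono (by simp))
  have h3 : wnorm (-((0 : ℕ) : ℤ)) (ofL2 (B f)).seq = ‖B f‖ := by
    rw [Nat.cast_zero, neg_zero]
    exact wnorm_zero_l2 _
  rw [h3] at h2
  calc wnorm q ((x.sandwich B).toCLM ξ).seq ≤ C * ‖B f‖ := h2
    _ ≤ C * (‖B‖ * D) := by
        gcongr
        exact (B.le_opNorm f).trans (by gcongr)
    _ = C * D * ‖B‖ := by ring

lemma tendsto_sandwich_zero (x : SmoothOp) {B : ℕ → (L2 →L[ℂ] L2)}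
    (hB : Tendsto B atTop (𝓝 0)) : Tendsto (fun n => x.sandwich (B n)) atTop (𝓝 0) := by
  rw [withSeminorms_opNorm.tendsto_nhds]
  intro q ε hε
  obtain ⟨C, hC⟩ := opNorm_sandwich_le x q
  have hlim := hB.norm.const_mul C
  rw [norm_zero, mul_zero] at hlim
  filter_upwards [hlim.eventually_lt_const hε] with n hn
  rw [sub_zero]
  exact (hC _).trans_lt hn

end SmoothOp

/-! ### Algebra of the spectral projections -/

namespace IsSpectralRepresentation

variable {x : SmoothOp} {lam : ℕ → ℂ} {P : ℕ → (L2 →L[ℂ] L2)}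

lemma proj_mul (h : IsSpectralRepresentation x lam P) (m n : ℕ) :
    P m * P n = if m = n then P n else 0 := by
  split_ifs with hmn
  · rw [hmn]
    exact (h.proj n).isIdempotentElem
  · exact h.proj_orthogonal m n hmn

/-- By orthogonality the partial sums multiplied by `P n` are constant once `N > n`. -/
lemma toL2_mul_proj (h : IsSpectralRepresentation x lam P) (n : ℕ) :
    x.toL2 * P n = lam n • P n := by
  refine tendsto_nhds_unique (h.tendsto_sum.mul_const (P n)) ?_
  refine tendsto_const_nhds.congr' ?_
  filter_upwards [eventually_gt_atTop n] with N hN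
  rw [Finset.sum_mul, Finset.sum_eq_single_of_mem n (Finset.mem_range.2 hN)]
  · rw [smul_mul_assoc, h.proj_mul, if_pos rfl]
  · intro m _ hm
    rw [smul_mul_assoc, h.proj_mul, if_neg hm, smul_zero]

lemma proj_mul_toL2 (h : IsSpectralRepresentation x lam P) (n : ℕ) :
    P n * x.toL2 = lam n • P n := by
  refine tendsto_nhds_unique (h.tendsto_sum.const_mul (P n)) ?_
  refine tendsto_const_nhds.congr' ?_
  filter_upwards [eventually_gt_atTop n] with N hN
  rw [Finset.mul_sum, Finset.sum_eq_single_of_mem n (Finset.mem_range.2 hN)]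
  · rw [mul_smul_comm, h.proj_mul, if_pos rfl]
  · intro m _ hm
    rw [mul_smul_comm, h.proj_mul, if_neg (Ne.symm hm), smul_zero]

lemma isStarProjection_sum (h : IsSpectralRepresentation x lam P) (N : ℕ) :
    IsStarProjection (∑ n ∈ Finset.range N, P n) := by
  induction N with
  | zero => simp
  | succ N ih =>
    rw [Finset.sum_range_succ]
    refine ih.add (h.proj N) ?_
    rw [Finset.sum_mul]
    exact Finset.sum_eq_zero fun m hm =>
      h.proj_orthogonal m N (Finset.mem_range.1 hm).ne

lemma isStarProjection_tail (h : IsSpectralRepresentation x lam P) (N : ℕ) :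
    IsStarProjection (1 - ∑ n ∈ Finset.range N, P n) :=
  (h.isStarProjection_sum N).one_sub

/-- Together with `tail_mul_toL2` this writes the remainder with the projection on either side: on
the left it controls the columns and, after taking adjoints, on the right it controls the rows. -/
lemma toL2_mul_tail (h : IsSpectralRepresentation x lam P) (N : ℕ) :
    x.toL2 * (1 - ∑ n ∈ Finset.range N, P n) =
      x.toL2 - ∑ n ∈ Finset.range N, lam n • P n := by
  rw [mul_sub, mul_one, Finset.mul_sum]
  simp only [h.toL2_mul_proj]

lemma tail_mul_toL2 (h : IsSpectralRepresentation x lam P) (N : ℕ) :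
    (1 - ∑ n ∈ Finset.range N, P n) * x.toL2 =
      x.toL2 - ∑ n ∈ Finset.range N, lam n • P n := by
  rw [sub_mul, one_mul, Finset.sum_mul]
  simp only [h.proj_mul_toL2]

lemma tendsto_toL2_tail (h : IsSpectralRepresentation x lam P) :
    Tendsto (fun N : ℕ => ‖x.toL2 - ∑ n ∈ Finset.range N, lam n • P n‖) atTop (𝓝 0) := by
  simpa using (h.tendsto_sum.const_sub x.toL2).norm

/-! ### Convergence of the spectral series in `L(s', s)` -/

/-- The spectral series converges in `L(s', s)` if its projections belong to `L(s', s)`. -/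
lemma tendsto_sum_smooth (h : IsSpectralRepresentation x lam P) {p : ℕ → SmoothOp}
    (hp : ∀ n, (p n).toL2 = P n) :
    Tendsto (fun N : ℕ => ∑ n ∈ Finset.range N, lam n • p n) atTop (𝓝 x) := by
  rw [SmoothOp.withSeminorms_opNorm.tendsto_nhds]
  intro q ε hε
  obtain ⟨C, hC, hb⟩ := SmoothOp.opNorm_le_of_dominated x q
  have hlim := ((Real.continuous_sqrt.tendsto 0).comp h.tendsto_toL2_tail).const_mul C
  rw [Real.sqrt_zero, mul_zero] at hlim
  filter_upwards [hlim.eventually_lt_const hε] with N hN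
  rw [map_sub_rev]
  set r := x - ∑ n ∈ Finset.range N, lam n • p n with hr
  have hrL : r.toL2 = x.toL2 - ∑ n ∈ Finset.range N, lam n • P n := by
    simp only [hr, map_sub, map_sum, map_smul, hp]
  have hE := h.isStarProjection_tail N
  have hcontr : ∀ f : L2, ‖(1 - ∑ n ∈ Finset.range N, P n) f‖ ≤ ‖f‖ := fun f =>
    (ContinuousLinearMap.le_opNorm _ f).trans
      (mul_le_of_le_one_left (norm_nonneg _) hE.norm_le)
  -- The adjoint of `x E` is `E x*`, so the contraction again acts last.
  have hrs : (star r).toL2 = (1 - ∑ n ∈ Finset.range N, P n) * (star x).toL2 := by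
    rw [SmoothOp.toL2_star, SmoothOp.toL2_star, hrL, ← h.toL2_mul_tail,
      ← ContinuousLinearMap.star_eq_adjoint, ← ContinuousLinearMap.star_eq_adjoint, star_mul,
      hE.isSelfAdjoint.star_eq]
  refine (hb r (fun k => ?_) (fun k => ?_)).trans_lt ?_
  · rw [hrL, ← h.tail_mul_toL2]
    exact hcontr _
  · rw [hrs]
    exact hcontr _
  · rw [hrL]
    exact hN

/-! ### Spectral projections as limits of polynomials in `x` -/

/-- The projections of a spectral representation belong to `L(s', s)`. -/
lemma toL2_sandwich_proj (h : IsSpectralRepresentation x lam P) (n : ℕ) :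
    (x.sandwich ((lam n ^ 2)⁻¹ • P n)).toL2 = P n := by
  have hl := h.lam_ne_zero n
  rw [SmoothOp.toL2_sandwich, mul_smul_comm, h.toL2_mul_proj, smul_mul_assoc, smul_mul_assoc,
    h.proj_mul_toL2, smul_smul, smul_smul]
  convert one_smul ℂ (P n) using 2
  field_simp

/-- A polynomial in `x` without constant term separating `λ_n` from finitely many `λ_m`. -/
lemma exists_separating (h : IsSpectralRepresentation x lam P)
    (A : NonUnitalStarSubalgebra ℂ SmoothOp) (hxA : x ∈ A) (n N : ℕ) :
    ∃ u ∈ A, Commute x u ∧ u.toL2 * P n = P n ∧ ∀ m < N, m ≠ n → u.toL2 * P m = 0 := by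
  have hsub : ∀ {m}, m ≠ n → lam n - lam m ≠ 0 := fun hm =>
    sub_ne_zero.2 fun e => hm (h.lam_injective e).symm
  induction N with
  | zero =>
    refine ⟨(lam n)⁻¹ • x, SMulMemClass.smul_mem _ hxA, (Commute.refl x).smul_right _, ?_, by simp⟩
    rw [map_smul, smul_mul_assoc, h.toL2_mul_proj, smul_smul, inv_mul_cancel₀ (h.lam_ne_zero n),
      one_smul]
  | succ N ih =>
    obtain ⟨u, huA, hc, hu, hz⟩ := ih
    by_cases hN : N = n
    · refine ⟨u, huA, hc, hu, fun m hm hmn => hz m ?_ hmn⟩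
      omega
    -- The new factor is `(x - λ_N) / (λ_n - λ_N)`, multiplied out since the algebra has no unit. It
    -- fixes `P n`, kills `P N`, and acts on every other `P m` by a scalar, so earlier zeros
    -- persist.
    · have hv : ∀ m, ((lam n - lam N)⁻¹ • (u * x - lam N • u)).toL2 * P m =
          ((lam n - lam N)⁻¹ * (lam m - lam N)) • (u.toL2 * P m) := by
        intro m
        rw [map_smul, map_sub, map_smul, SmoothOp.toL2_mul, smul_mul_assoc, sub_mul, mul_assoc,
          h.toL2_mul_proj, mul_smul_comm, smul_mul_assoc, ← sub_smul, smul_smul]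
      refine ⟨(lam n - lam N)⁻¹ • (u * x - lam N • u),
        SMulMemClass.smul_mem _ (sub_mem (mul_mem huA hxA) (SMulMemClass.smul_mem _ huA)),
        ((hc.mul_right (Commute.refl x)).sub_right (hc.smul_right _)).smul_right _, ?_, ?_⟩
      · rw [hv, hu, inv_mul_cancel₀ (hsub hN), one_smul]
      · intro m hm hmn
        rw [hv]
        rcases Nat.lt_succ_iff_lt_or_eq.1 hm with hlt | rfl
        · rw [hz m hlt hmn, smul_zero]
        · rw [sub_self, mul_zero, zero_smul]

/-- The projections of a spectral representation of `x` belong to each closed subalgebra that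
contains `x`. -/
lemma smooth_proj_mem (h : IsSpectralRepresentation x lam P)
    (A : NonUnitalStarSubalgebra ℂ SmoothOp) (hA : IsClosed (A : Set SmoothOp)) (hxA : x ∈ A)
    (n : ℕ) : x.sandwich ((lam n ^ 2)⁻¹ • P n) ∈ A := by
  have hl := h.lam_ne_zero n
  obtain ⟨N, hNn, hN⟩ := ((eventually_gt_atTop n).and
    (h.tendsto_toL2_tail.eventually_lt_const (norm_pos_iff.2 hl))).exists
  obtain ⟨u, huA, hc, hu, hz⟩ := h.exists_separating A hxA n N
  set E := 1 - ∑ m ∈ Finset.range N, P m with hE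
  set M : L2 →L[ℂ] L2 := (lam n)⁻¹ • x.toL2 with hM
  have hcL : Commute x.toL2 u.toL2 := by
    have := congrArg SmoothOp.toL2 hc.eq
    rwa [SmoothOp.toL2_mul, SmoothOp.toL2_mul] at this
  have hcM : Commute M u.toL2 := hcL.smul_left _
  have hME : Commute M E :=
    Commute.smul_left ((h.toL2_mul_tail N).trans (h.tail_mul_toL2 N).symm) _
  have hMP : M * P n = P n := by
    rw [hM, smul_mul_assoc, h.toL2_mul_proj, smul_smul, inv_mul_cancel₀ hl, one_smul]
  have hPM : P n * M = P n := by
    rw [hM, mul_smul_comm, h.proj_mul_toL2, smul_smul, inv_mul_cancel₀ hl, one_smul]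
  -- Both `u` and `P n` give `P n` when multiplied by the finite sum of projections, so their
  -- difference lives on the tail alone.
  have hV : (u.toL2 - P n) * E = u.toL2 - P n := by
    have e1 : u.toL2 * ∑ m ∈ Finset.range N, P m = P n := by
      rw [Finset.mul_sum, Finset.sum_eq_single_of_mem n (Finset.mem_range.2 hNn), hu]
      exact fun m hm hmn => hz m (Finset.mem_range.1 hm) hmn
    have e2 : P n * ∑ m ∈ Finset.range N, P m = P n := by
      rw [Finset.mul_sum, Finset.sum_eq_single_of_mem n (Finset.mem_range.2 hNn), h.proj_mul,
        if_pos rfl]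
      exact fun m _ hmn => h.proj_orthogonal n m (Ne.symm hmn)
    rw [hE, mul_sub, mul_one, sub_mul, e1, e2, sub_self, sub_zero]
  have hVM : Commute M (u.toL2 - P n) := hcM.sub_right (hMP.trans hPM.symm)
  have hnorm : ‖M * E‖ < 1 := by
    rw [hM, smul_mul_assoc, h.toL2_mul_tail, norm_smul, norm_inv, inv_mul_lt_iff₀
      (norm_pos_iff.2 hl), mul_one]
    exact hN
  set B : ℕ → (L2 →L[ℂ] L2) := fun k => (u.toL2 - P n) * M ^ k with hB
  have hBlim : Tendsto B atTop (𝓝 0) := by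
    -- As `M` commutes with `E`, each power of `M` can absorb a copy of `E`, and `‖M E‖ < 1` gives
    -- geometric decay.
    have e : ∀ k, B k = (u.toL2 - P n) * (M * E) ^ k := by
      intro k
      have hVE : (u.toL2 - P n) * E ^ k = u.toL2 - P n := by
        induction k with
        | zero => rw [pow_zero, mul_one]
        | succ k ih => rw [pow_succ, ← mul_assoc, ih, hV]
      rw [hME.mul_pow, (hME.pow_pow k k).eq, ← mul_assoc, hVE]
    have := (tendsto_pow_atTop_nhds_zero_of_norm_lt_one hnorm).const_mul (u.toL2 - P n)
    rw [mul_zero] at this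
    exact this.congr fun k => (e k).symm
  -- These are the smooth operators `u M^k`, built by iteration so that no unit is needed.
  set w : ℕ → SmoothOp := fun k => (fun y => (lam n)⁻¹ • (y * x))^[k] u with hw
  have hwA : ∀ k, w k ∈ A := by
    intro k
    induction k with
    | zero => exact huA
    | succ k ih =>
      rw [hw]
      simp only [Function.iterate_succ_apply']
      exact SMulMemClass.smul_mem _ (mul_mem ih hxA)
  have hwL : ∀ k, (w k).toL2 = u.toL2 * M ^ k := by
    intro k
    induction k with
    | zero => rw [pow_zero, mul_one]; rfl
    | succ k ih =>
      have : w (k + 1) = (lam n)⁻¹ • (w k * x) := Function.iterate_succ_apply' _ k u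
      rw [this, map_smul, SmoothOp.toL2_mul, ih, pow_succ, hM, ← mul_assoc, mul_smul_comm]
  have hPk : ∀ k, P n * M ^ k = P n := by
    intro k
    induction k with
    | zero => rw [pow_zero, mul_one]
    | succ k ih => rw [pow_succ, ← mul_assoc, ih, hPM]
  -- The shift by `2` releases one factor `M` for each side, which makes the error `M B_k M` a
  -- sandwich by `x` and hence small in `L(s', s)`.
  have hdiff : ∀ k, w (k + 2) = x.sandwich ((lam n ^ 2)⁻¹ • P n) +
      x.sandwich ((lam n ^ 2)⁻¹ • B k) := by
    intro k
    refine SmoothOp.toL2_injective ?_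
    have e3 : (x.sandwich ((lam n ^ 2)⁻¹ • B k)).toL2 = M * B k * M := by
      rw [SmoothOp.toL2_sandwich, hM]
      simp only [mul_smul_comm, smul_mul_assoc, smul_smul]
      congr 1
      rw [sq, mul_inv]
    have e4 : M * B k * M = B (k + 2) := by
      simp only [hB]
      rw [← mul_assoc, hVM.eq, mul_assoc, mul_assoc, ← pow_succ, ← pow_succ']
    rw [map_add, h.toL2_sandwich_proj, e3, e4, hwL]
    simp only [hB]
    rw [sub_mul, hPk, add_sub_cancel]
  have hlim : Tendsto (fun k => w (k + 2)) atTop (𝓝 (x.sandwich ((lam n ^ 2)⁻¹ • P n))) := by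
    have hB2 := hBlim.const_smul ((lam n ^ 2)⁻¹)
    rw [smul_zero] at hB2
    have hs := SmoothOp.tendsto_sandwich_zero x hB2
    rw [SmoothOp.withSeminorms_opNorm.tendsto_nhds] at hs ⊢
    simp only [hdiff, add_sub_cancel_left]
    simpa only [sub_zero] using hs
  exact hA.mem_of_tendsto hlim (Eventually.of_forall fun k => hwA _)

end IsSpectralRepresentation

end SmoothOperators

theorem mainTheorem11
    (A : NonUnitalStarSubalgebra ℂ SmoothOperators.SmoothOp)
    (hA : IsClosed (A : Set SmoothOperators.SmoothOp))
    (x : SmoothOperators.SmoothOp) (hx : IsStarNormal x)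
    (hinf : ¬ FiniteDimensional ℂ x.toL2.range)
    (lam : ℕ → ℂ) (P : ℕ → (SmoothOperators.L2 →L[ℂ] SmoothOperators.L2))
    (hrep : SmoothOperators.IsSpectralRepresentation x lam P) :
    x ∈ A ↔ ∀ n, ∃ p ∈ A, p.toL2 = P n := by
  constructor
  · exact fun hxA n => ⟨_, hrep.smooth_proj_mem A hA hxA n, hrep.toL2_sandwich_proj n⟩
  · intro h
    choose p hpA hp using h
    refine hA.mem_of_tendsto (hrep.tendsto_sum_smooth hp) (Eventually.of_forall fun N => ?_)
    exact sum_mem fun n _ => SMulMemClass.smul_mem _ (hpA n)
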